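/- There is a universal constant $C>0$ such that the following holds. Let $d\ge 1$ and let $A_*\in\mathbb{R}^{d\times d}$ have spectral radius $\rho(A_*)<1$ (the largest modulus of a complex eigenvalue). Then the limit $\Gamma_\infty:=\lim_{t\to\infty}\Gamma_t$ of the controllability Gramians $\Gamma_t:=\sum_{s=0}^{t-1}A_*^s(A_*^s)^\top$ exists. Moreover, for every $\delta\in(0,1/2)$ there is a time $T_0$, depending only on $A_*$ and $\delta$, such that for every $\sigma>0$, every linear dynamical system $X_0=0$, $X_{t+1}=A_*X_t+\eta_t$ with $\eta_0,\eta_1,\dots$ i.i.d. $\mathcal N(0,\sigma^2 I_d)$, and every $T>T_0$, with probability at least $1-\delta$ every ordinary least-squares estimate $\widehat A(T)\in\arg\min_{A\in\mathbb{R}^{d\times d}}\sum_{t=1}^T\tfrac12\|X_{t+1}-AX_t\|_2^2$ satisfies $$\|\widehat A(T)-A_*\|_{\mathrm{op}}\;\le\; C\sqrt{\frac{d\,\log(d/\delta)}{T\,\lambda_{\min}(\Gamma_\infty)}},$$ where $\|\cdot\|_{\mathrm{op}}$ is the Euclidean operator norm and $\lambda_{\min}$ the smallest eigenvalue. -/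

import Mathlib

open Filter Topology MeasureTheory ProbabilityTheory

namespace LinSysId

/-- The spectral radius `ρ(A)` of a real square matrix: the largest modulus of a complex
eigenvalue. The matrix is complexified, since over `ℝ` only its real eigenvalues would count. -/
noncomputable def specRadius {d : ℕ} (A : Matrix (Fin d) (Fin d) ℝ) : ENNReal :=
  spectralRadius ℂ (A.map (algebraMap ℝ ℂ))

/-- The finite-time controllability Gramian `Γ_t = ∑_{s=0}^{t-1} A^s (A^s)ᵀ`. -/
def gramian {d : ℕ} (A : Matrix (Fin d) (Fin d) ℝ) (t : ℕ) : Matrix (Fin d) (Fin d) ℝ :=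
  ∑ s ∈ Finset.range t, A ^ s * (A ^ s).transpose

/-- The smallest eigenvalue `λ_min(M)` of a symmetric matrix `M` of size at least one (the real
spectrum of such a matrix is finite and nonempty, so the infimum is its minimum). -/
noncomputable def lambdaMin {d : ℕ} (M : Matrix (Fin d) (Fin d) ℝ) : ℝ :=
  sInf (spectrum ℝ M)

/-- `lambdaMin` is the least eigenvalue. -/
theorem isLeast_lambdaMin {d : ℕ} (hd : 1 ≤ d) {M : Matrix (Fin d) (Fin d) ℝ}
    (hM : M.IsHermitian) : IsLeast (spectrum ℝ M) (lambdaMin M) := by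
  have : Nonempty (Fin d) := ⟨⟨0, hd⟩⟩
  have h := hM.spectrum_real_eq_range_eigenvalues
  have hne : (spectrum ℝ M).Nonempty := by rw [h]; exact Set.range_nonempty _
  have hfin : (spectrum ℝ M).Finite := by rw [h]; exact Set.finite_range _
  exact ⟨hne.csInf_mem hfin, fun x hx => csInf_le hfin.bddBelow hx⟩

/-- The operator norm of a real matrix with respect to the Euclidean norm. -/
noncomputable def opNorm {d : ℕ} (M : Matrix (Fin d) (Fin d) ℝ) : ℝ :=
  ‖Matrix.toEuclideanCLM (n := Fin d) (𝕜 := ℝ) M‖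

/-- The least-squares objective `∑_{t=1}^T ½ ‖x_{t+1} - B x_t‖²` of a trajectory `x`. -/
noncomputable def lsLoss {d : ℕ} (x : ℕ → EuclideanSpace ℝ (Fin d)) (T : ℕ)
    (B : Matrix (Fin d) (Fin d) ℝ) : ℝ :=
  ∑ t ∈ Finset.Icc 1 T,
    (1 / 2 : ℝ) * ‖x (t + 1) - Matrix.toEuclideanCLM (n := Fin d) (𝕜 := ℝ) B (x t)‖ ^ 2

/-- `Ahat` is an ordinary least-squares estimate from the trajectory `x_1, …, x_{T+1}`:
`Ahat ∈ argmin_B ∑_{t=1}^T ½ ‖x_{t+1} - B x_t‖²`. -/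
def IsOLS {d : ℕ} (x : ℕ → EuclideanSpace ℝ (Fin d)) (T : ℕ)
    (Ahat : Matrix (Fin d) (Fin d) ℝ) : Prop :=
  ∀ B : Matrix (Fin d) (Fin d) ℝ, lsLoss x T Ahat ≤ lsLoss x T B

/-- A linear image of a finite-dimensional space contains a point closest to a given one. -/
theorem exists_min_norm_sub {V F : Type*} [AddCommGroup V] [Module ℝ V] [FiniteDimensional ℝ V]
    [NormedAddCommGroup F] [InnerProductSpace ℝ F] (L : V →ₗ[ℝ] F) (y : F) :
    ∃ a, ∀ b, ‖y - L a‖ ≤ ‖y - L b‖ := by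
  obtain ⟨v, ⟨a, rfl⟩, hv⟩ :=
    (LinearMap.range L).exists_norm_eq_iInf_of_complete_subspace
      (Submodule.complete_of_finiteDimensional _) y
  refine ⟨a, fun b => ?_⟩
  rw [hv]
  exact ciInf_le (f := fun w : LinearMap.range L => ‖y - w‖)
    ⟨0, by rintro _ ⟨w, rfl⟩; exact norm_nonneg _⟩ ⟨L b, b, rfl⟩

/-- The argmin is never empty: every trajectory has an ordinary least-squares estimate. -/
theorem exists_isOLS {d : ℕ} (x : ℕ → EuclideanSpace ℝ (Fin d)) (T : ℕ) :
    ∃ Ahat, IsOLS x T Ahat := by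
  let L : Matrix (Fin d) (Fin d) ℝ →ₗ[ℝ]
      PiLp 2 (fun _ : Finset.Icc 1 T => EuclideanSpace ℝ (Fin d)) :=
    { toFun := fun B => WithLp.toLp 2
        (fun t => Matrix.toEuclideanCLM (n := Fin d) (𝕜 := ℝ) B (x t.1))
      map_add' := by intro B C; rw [← WithLp.toLp_add]; congr 1; funext t; simp
      map_smul' := by intro c B; rw [← WithLp.toLp_smul]; congr 1; funext t; simp }
  obtain ⟨A, hA⟩ := exists_min_norm_sub L (WithLp.toLp 2 (fun t => x (t.1 + 1)))
  have hloss : ∀ B, lsLoss x T B =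
      (1 / 2 : ℝ) * ‖WithLp.toLp 2 (fun t : Finset.Icc 1 T => x (t.1 + 1)) - L B‖ ^ 2 := by
    intro B
    rw [PiLp.norm_sq_eq_of_L2, lsLoss, ← Finset.mul_sum, ← Finset.sum_coe_sort]
    rfl
  refine ⟨A, fun B => ?_⟩
  rw [hloss, hloss]
  have := hA B
  gcongr

/-- `X` is the trajectory of the linear dynamical system `X_{t+1} = A X_t + η_t` started at
`X_0 = 0`, where the noise vectors `η_0, η_1, …` are i.i.d. `N(0, σ² I)`. -/
structure IsLinearSystem {d : ℕ} {Ω : Type*} [MeasurableSpace Ω] (P : Measure Ω)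
    (A : Matrix (Fin d) (Fin d) ℝ) (σ : ℝ) (η X : ℕ → Ω → EuclideanSpace ℝ (Fin d)) : Prop where
  noise_indep : iIndepFun η P
  noise_law : ∀ t, HasLaw (η t)
    (multivariateGaussian 0 (σ ^ 2 • (1 : Matrix (Fin d) (Fin d) ℝ))) P
  init : ∀ ω, X 0 ω = 0
  step : ∀ t ω, X (t + 1) ω =
    Matrix.toEuclideanCLM (n := Fin d) (𝕜 := ℝ) A (X t ω) + η t ω

end LinSysId

/-! Write E(v) = ∑⟪v, X_t⟫² for the empirical energy. Since X_0 = 0, shifting the time index gives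
E(v) - E(Aᵀv) = Tσ²‖v‖² + martingale - ⟪Aᵀv, X_T⟫². Second moments make the last two terms small
compared with Tσ² once T is large, so E satisfies a Lyapunov equation up to a factor 1 ± 1/2.
Iterating it along the orbit of Aᵀ gives E(v) between 1/2 and 3/2 times Tσ²⟪v, Γv⟫
(`energy_bounds`). Only order d² directions need control here, so Chebyshev suffices and its poor
dependence on A and δ goes into T₀.

The sharp rate comes from the noise-state correlation S(u, v) = ∑⟪u, η_t⟫⟪v, X_t⟫. Its exponential
martingale has mean one, the energy upper bound makes the compensator deterministic, and a union
over pairs in a 1/2-net costs only 25^d (`IsLinearSystem.lintegral_exp_logLikelihood`).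

With r = (Â - A)ᵀu, optimality of Â gives E(r) ≤ 2 S(u, r) (`IsOLS.sum_sq_le`). The left side is
quadratic and the right side linear in the Γ-norm of r; dividing bounds that norm, and λ_min(Γ)
converts it to ‖r‖ (`IsOLS.opNorm_sub_le`). -/

namespace LinSysId

open scoped RealInnerProductSpace NNReal ENNReal

/-! ### Nets of the unit ball and bounds on (bi)linear forms -/

section Nets

variable {E : Type*} [NormedAddCommGroup E] [NormedSpace ℝ E] [FiniteDimensional ℝ E]

/-- The unit ball of a `d`-dimensional normed space has a `1/2`-net of at most `5 ^ d` points. -/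
theorem exists_half_net (E : Type*) [NormedAddCommGroup E] [NormedSpace ℝ E]
    [FiniteDimensional ℝ E] :
    ∃ N : Finset E, N.card ≤ 5 ^ Module.finrank ℝ E ∧ (∀ v ∈ N, ‖v‖ ≤ 1) ∧
      ∀ x : E, ‖x‖ ≤ 1 → ∃ v ∈ N, ‖x - v‖ ≤ 1 / 2 := by
  classical
  -- A largest 1-separated subset of the ball of radius 2, halved, is the net: a point x far from it
  -- would let 2x be added.
  set S : Set ℕ := {n | ∃ s : Finset E, s.card = n ∧ (∀ c ∈ s, ‖c‖ ≤ 2) ∧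
    ∀ c ∈ s, ∀ d ∈ s, c ≠ d → 1 ≤ ‖c - d‖} with hS
  have hbdd : BddAbove S := by
    refine ⟨5 ^ Module.finrank ℝ E, ?_⟩
    rintro _ ⟨s, rfl, h1, h2⟩
    exact Besicovitch.card_le_of_separated s h1 h2
  have hne : S.Nonempty := ⟨0, ∅, by simp⟩
  obtain ⟨s, hcard, h1, h2⟩ := Nat.sSup_mem hne hbdd
  refine ⟨s.image (fun v => (1 / 2 : ℝ) • v), ?_, ?_, ?_⟩
  · exact Finset.card_image_le.trans (Besicovitch.card_le_of_separated s h1 h2)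
  · intro v hv
    obtain ⟨w, hw, rfl⟩ := Finset.mem_image.1 hv
    have := h1 w hw
    rw [norm_smul]
    norm_num
    linarith
  · intro x hx
    by_contra! hcon
    have hfar : ∀ v ∈ s, 1 < ‖(2 : ℝ) • x - v‖ := by
      intro v hv
      have h := hcon _ (Finset.mem_image_of_mem _ hv)
      have e : x - (1 / 2 : ℝ) • v = (1 / 2 : ℝ) • ((2 : ℝ) • x - v) := by
        rw [smul_sub, smul_smul]; norm_num
      rw [e, norm_smul] at h
      norm_num at h
      linarith
    have hnot : (2 : ℝ) • x ∉ s := fun hmem => by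
      have := hfar _ hmem
      simp at this
      linarith
    have hmem : (insert ((2 : ℝ) • x) s).card ∈ S := by
      refine ⟨_, rfl, ?_, ?_⟩
      · intro c hc
        rcases Finset.mem_insert.1 hc with rfl | hc
        · rw [norm_smul]; norm_num; linarith
        · exact h1 c hc
      · intro c hc e he hce
        rcases Finset.mem_insert.1 hc with rfl | hc <;> rcases Finset.mem_insert.1 he with rfl | he
        · exact absurd rfl hce
        · exact (hfar e he).le
        · rw [norm_sub_rev]; exact (hfar c hc).le
        · exact h2 c hc e he hce
    have := le_csSup hbdd hmem
    rw [Finset.card_insert_of_notMem hnot, hcard] at this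
    omega

/-- Passing to a net point costs at most half the norm of the functional, which is absorbed on the
left. One-sided bounds suffice because the ball is symmetric. -/
theorem apply_le_of_half_net {N : Finset E}
    (hN : ∀ x : E, ‖x‖ ≤ 1 → ∃ v ∈ N, ‖x - v‖ ≤ 1 / 2) (f : E →ₗ[ℝ] ℝ) {K : ℝ}
    (hK : ∀ v ∈ N, f v ≤ K) (x : E) : f x ≤ 2 * K * ‖x‖ := by
  set g : E →L[ℝ] ℝ := LinearMap.toContinuousLinearMap f with hg
  have hgf : ∀ x, g x = f x := fun x => rfl
  have key : ∀ x : E, ‖x‖ ≤ 1 → f x ≤ K + ‖g‖ / 2 := by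
    intro x hx
    obtain ⟨v, hv, hxv⟩ := hN x hx
    have h1 : f x = f v + g (x - v) := by rw [hgf, map_sub]; ring
    have h2 : g (x - v) ≤ ‖g‖ * (1 / 2) :=
      (le_abs_self _).trans ((g.le_opNorm _).trans (by gcongr))
    have := hK v hv
    linarith
  have hK0 : 0 ≤ K + ‖g‖ / 2 := by simpa using key 0 (by simp)
  have hnorm : ‖g‖ ≤ K + ‖g‖ / 2 := by
    refine g.opNorm_le_of_unit_norm hK0 fun x hx => ?_
    rw [Real.norm_eq_abs, abs_le]
    have h1 := key x hx.le
    have h2 := key (-x) (by rw [norm_neg]; exact hx.le)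
    rw [map_neg] at h2
    rw [hgf]
    constructor <;> linarith
  calc f x ≤ ‖g‖ * ‖x‖ := (le_abs_self _).trans (g.le_opNorm x)
    _ ≤ 2 * K * ‖x‖ := by gcongr; linarith

theorem apply₂_le_of_half_net {N : Finset E}
    (hN : ∀ x : E, ‖x‖ ≤ 1 → ∃ v ∈ N, ‖x - v‖ ≤ 1 / 2) (f : E →ₗ[ℝ] E →ₗ[ℝ] ℝ) {K : ℝ}
    (hK : ∀ u ∈ N, ∀ v ∈ N, f u v ≤ K) (x y : E) : f x y ≤ 4 * K * ‖x‖ * ‖y‖ := by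
  have h1 : ∀ u ∈ N, f.flip y u ≤ 2 * K * ‖y‖ := fun u hu =>
    apply_le_of_half_net hN (f u) (hK u hu) y
  have := apply_le_of_half_net hN (f.flip y) h1 x
  rw [LinearMap.flip_apply] at this
  linarith

end Nets

/-! ### Lyapunov inequalities iterated along an orbit -/

section Lyapunov

variable {E : Type*} [NormedAddCommGroup E]

theorem tendsto_iterate_of_tendsto_sum_sq {L : E → E} {v : E} {q : ℝ}
    (hq : Tendsto (fun k => ∑ s ∈ Finset.range k, ‖L^[s] v‖ ^ 2) atTop (𝓝 q)) :
    Tendsto (fun k => L^[k] v) atTop (𝓝 0) := by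
  have h : Tendsto (fun k => ‖L^[k] v‖ ^ 2) atTop (𝓝 0) := by
    have := ((tendsto_add_atTop_iff_nat 1).2 hq).sub hq
    simpa [Finset.sum_range_succ] using this
  rw [tendsto_zero_iff_norm_tendsto_zero]
  simpa using h.sqrt

/-- The inequality telescopes along the orbit; the remainder is nonnegative and can be dropped. -/
theorem mul_le_of_lyapunov {L : E → E} {g : E → ℝ} {c : ℝ} (hg : ∀ v, 0 ≤ g v)
    (h : ∀ v, g (L v) + c * ‖v‖ ^ 2 ≤ g v) {v : E} {q : ℝ}
    (hq : Tendsto (fun k => ∑ s ∈ Finset.range k, ‖L^[s] v‖ ^ 2) atTop (𝓝 q)) :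
    c * q ≤ g v := by
  have key : ∀ k, g (L^[k] v) + c * ∑ s ∈ Finset.range k, ‖L^[s] v‖ ^ 2 ≤ g v := by
    intro k
    induction k with
    | zero => simp
    | succ k ih =>
      have := h (L^[k] v)
      rw [Finset.sum_range_succ, Function.iterate_succ_apply']
      linarith
  refine le_of_tendsto (hq.const_mul c) (Eventually.of_forall fun k => ?_)
  linarith [key k, hg (L^[k] v)]

/-- In this direction the telescoped remainder must vanish: summability sends the orbit to 0, where
g is continuous. -/
theorem le_mul_of_lyapunov {L : E → E} {g : E → ℝ} {c : ℝ} (hg : ContinuousAt g 0) (hg0 : g 0 = 0)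
    (h : ∀ v, g v ≤ g (L v) + c * ‖v‖ ^ 2) {v : E} {q : ℝ}
    (hq : Tendsto (fun k => ∑ s ∈ Finset.range k, ‖L^[s] v‖ ^ 2) atTop (𝓝 q)) :
    g v ≤ c * q := by
  have key : ∀ k, g v ≤ g (L^[k] v) + c * ∑ s ∈ Finset.range k, ‖L^[s] v‖ ^ 2 := by
    intro k
    induction k with
    | zero => simp
    | succ k ih =>
      have := h (L^[k] v)
      rw [Finset.sum_range_succ, Function.iterate_succ_apply']
      linarith
  have hlim : Tendsto (fun k => g (L^[k] v)) atTop (𝓝 0) := by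
    rw [← hg0]
    exact hg.tendsto.comp (tendsto_iterate_of_tendsto_sum_sq hq)
  have := ge_of_tendsto (hlim.add (hq.const_mul c)) (Eventually.of_forall key)
  simpa using this

end Lyapunov

/-! ### The Gramian as a quadratic form, and its limit -/

section Gramian

variable {d : ℕ}

/-- The continuous linear map of a real square matrix on Euclidean space. -/
noncomputable abbrev clm (A : Matrix (Fin d) (Fin d) ℝ) :
    EuclideanSpace ℝ (Fin d) →L[ℝ] EuclideanSpace ℝ (Fin d) :=
  Matrix.toEuclideanCLM (n := Fin d) (𝕜 := ℝ) A

theorem inner_clm_transpose (A : Matrix (Fin d) (Fin d) ℝ) (x y : EuclideanSpace ℝ (Fin d)) :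
    ⟪clm A.transpose x, y⟫ = ⟪x, clm A y⟫ := by
  have h : clm A.transpose = ContinuousLinearMap.adjoint (clm A) := by
    rw [← ContinuousLinearMap.star_eq_adjoint, ← map_star, Matrix.star_eq_conjTranspose,
      Matrix.conjTranspose_eq_transpose_of_trivial]
  rw [h, ContinuousLinearMap.adjoint_inner_left]

theorem clm_pow_apply (A : Matrix (Fin d) (Fin d) ℝ) (s : ℕ) (v : EuclideanSpace ℝ (Fin d)) :
    clm (A ^ s) v = (clm A)^[s] v := by
  induction s with
  | zero => simp
  | succ s ih =>
    rw [pow_succ', clm, map_mul, mul_apply_eq_comp, ih, Function.iterate_succ_apply']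

theorem inner_clm_gramian (A : Matrix (Fin d) (Fin d) ℝ) (t : ℕ)
    (v : EuclideanSpace ℝ (Fin d)) :
    ⟪v, clm (gramian A t) v⟫ = ∑ s ∈ Finset.range t, ‖(clm A.transpose)^[s] v‖ ^ 2 := by
  rw [gramian, clm, map_sum, _root_.sum_apply, inner_sum]
  refine Finset.sum_congr rfl fun s _ => ?_
  rw [map_mul, mul_apply_eq_comp, ← inner_clm_transpose, ← real_inner_self_eq_norm_sq,
    ← clm_pow_apply, Matrix.transpose_pow]

theorem tendsto_sum_sq_of_tendsto_gramian {A Γ : Matrix (Fin d) (Fin d) ℝ}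
    (h : Tendsto (gramian A) atTop (𝓝 Γ)) (v : EuclideanSpace ℝ (Fin d)) :
    Tendsto (fun k => ∑ s ∈ Finset.range k, ‖(clm A.transpose)^[s] v‖ ^ 2) atTop
      (𝓝 ⟪v, clm Γ v⟫) := by
  simp_rw [← inner_clm_gramian, Matrix.inner_toEuclideanCLM]
  have hc : Continuous fun M : Matrix (Fin d) (Fin d) ℝ => v.ofLp ⬝ᵥ M.mulVec v.ofLp := by
    fun_prop
  exact (hc.tendsto Γ).comp h

/-- The s = 0 term of the Gramian is already the identity. -/
theorem norm_sq_le_inner_of_tendsto_gramian {A Γ : Matrix (Fin d) (Fin d) ℝ}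
    (h : Tendsto (gramian A) atTop (𝓝 Γ)) (v : EuclideanSpace ℝ (Fin d)) :
    ‖v‖ ^ 2 ≤ ⟪v, clm Γ v⟫ := by
  refine ge_of_tendsto (tendsto_sum_sq_of_tendsto_gramian h v) ?_
  filter_upwards [eventually_ge_atTop 1] with k hk
  simpa using Finset.single_le_sum (f := fun s => ‖(clm A.transpose)^[s] v‖ ^ 2)
    (fun s _ => sq_nonneg _) (Finset.mem_range.2 hk)

theorem sum_sq_le_inner_of_tendsto_gramian {A Γ : Matrix (Fin d) (Fin d) ℝ}
    (h : Tendsto (gramian A) atTop (𝓝 Γ)) (v : EuclideanSpace ℝ (Fin d)) (k : ℕ) :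
    ∑ s ∈ Finset.range k, ‖(clm A.transpose)^[s] v‖ ^ 2 ≤ ⟪v, clm Γ v⟫ := by
  refine ge_of_tendsto (tendsto_sum_sq_of_tendsto_gramian h v) ?_
  filter_upwards [eventually_ge_atTop k] with n hn
  exact Finset.sum_le_sum_of_subset_of_nonneg (Finset.range_mono hn) fun s _ _ => sq_nonneg _

theorem posDef_of_tendsto_gramian {A Γ : Matrix (Fin d) (Fin d) ℝ}
    (h : Tendsto (gramian A) atTop (𝓝 Γ)) : Γ.PosDef := by
  have hherm : Γ.IsHermitian := by
    have h1 : Tendsto (fun t => (gramian A t).conjTranspose) atTop (𝓝 Γ.conjTranspose) :=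
      ((continuous_id.matrix_conjTranspose).tendsto Γ).comp h
    have h2 : ∀ t, (gramian A t).conjTranspose = gramian A t := by
      intro t
      rw [gramian, Matrix.conjTranspose_sum]
      simp [Matrix.conjTranspose_eq_transpose_of_trivial, Matrix.transpose_mul]
    simp_rw [h2] at h1
    exact tendsto_nhds_unique h1 h
  refine .of_dotProduct_mulVec_pos hherm fun x hx => ?_
  have h1 := norm_sq_le_inner_of_tendsto_gramian h (WithLp.toLp 2 x)
  rw [Matrix.inner_toEuclideanCLM] at h1
  have h2 : 0 < ‖WithLp.toLp 2 x‖ := by simpa using hx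
  have : 0 < ‖WithLp.toLp 2 x‖ ^ 2 := by positivity
  simpa using this.trans_le h1

theorem lambdaMin_pos (hd : 1 ≤ d) {M : Matrix (Fin d) (Fin d) ℝ} (hM : M.PosDef) :
    0 < lambdaMin M := by
  have h := (isLeast_lambdaMin hd hM.1).1
  rw [hM.1.spectrum_real_eq_range_eigenvalues] at h
  obtain ⟨i, hi⟩ := h
  rw [← hi]
  exact hM.eigenvalues_pos i

theorem lambdaMin_mul_norm_sq_le (hd : 1 ≤ d) {M : Matrix (Fin d) (Fin d) ℝ} (hM : M.IsHermitian)
    (v : EuclideanSpace ℝ (Fin d)) : lambdaMin M * ‖v‖ ^ 2 ≤ ⟪v, clm M v⟫ := by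
  have hpsd : (M - algebraMap ℝ _ (lambdaMin M)).PosSemidef := by
    rw [Matrix.posSemidef_iff_isHermitian_and_spectrum_nonneg]
    refine ⟨hM.sub ?_, ?_⟩
    · rw [Algebra.algebraMap_eq_smul_one]
      simp [Matrix.IsHermitian]
    · rw [← spectrum.sub_singleton_eq]
      rintro _ ⟨a, ha, b, rfl, rfl⟩
      exact sub_nonneg.2 ((isLeast_lambdaMin hd hM).2 ha)
  have h := hpsd.dotProduct_mulVec_nonneg v.ofLp
  rw [Matrix.sub_mulVec, dotProduct_sub, Algebra.algebraMap_eq_smul_one, Matrix.smul_mulVec,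
    Matrix.one_mulVec, dotProduct_smul, star_trivial, smul_eq_mul, sub_nonneg] at h
  rw [Matrix.inner_toEuclideanCLM, EuclideanSpace.norm_sq_eq]
  simpa [dotProduct, sq] using h

-- Factoring M = BᵀB supplies coordinates in which the M-norm is Euclidean, so that a net of the
-- Euclidean ball serves the Γ-norm.
open scoped MatrixOrder in
theorem exists_linearEquiv_norm_sq_eq {M : Matrix (Fin d) (Fin d) ℝ} (hM : M.PosDef) :
    ∃ e : EuclideanSpace ℝ (Fin d) ≃ₗ[ℝ] EuclideanSpace ℝ (Fin d),
      ∀ v, ‖e v‖ ^ 2 = ⟪v, clm M v⟫ := by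
  obtain ⟨B, hB⟩ := CStarAlgebra.nonneg_iff_eq_star_mul_self.mp hM.posSemidef.nonneg
  have hnorm : ∀ v, ‖clm B v‖ ^ 2 = ⟪v, clm M v⟫ := by
    intro v
    rw [hB, clm, clm, map_mul, mul_apply_eq_comp, Matrix.star_eq_conjTranspose,
      Matrix.conjTranspose_eq_transpose_of_trivial, real_inner_comm, inner_clm_transpose,
      real_inner_self_eq_norm_sq]
  have hinj : Function.Injective (clm B).toLinearMap := by
    rw [← LinearMap.ker_eq_bot, LinearMap.ker_eq_bot']
    intro v hv
    by_contra hne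
    have h1 : v.ofLp ≠ 0 := by simpa using hne
    have h2 := hM.dotProduct_mulVec_pos h1
    have h3 := hnorm v
    rw [Matrix.inner_toEuclideanCLM, show clm B v = 0 from hv] at h3
    simp at h3 h2
    linarith
  exact ⟨LinearEquiv.ofInjectiveEndo _ hinj, fun v => hnorm v⟩

-- Gelfand's formula gives ‖M^n‖ ≤ r^n eventually for some r < 1, so the series is dominated by a
-- geometric one. The work is done over ℂ and real parts are taken at the end.
open scoped Matrix.Norms.L2Operator in
theorem exists_tendsto_gramian {A : Matrix (Fin d) (Fin d) ℝ} (hA : specRadius A < 1) :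
    ∃ Γ, Tendsto (gramian A) atTop (𝓝 Γ) := by
  set M : Matrix (Fin d) (Fin d) ℂ := A.map (algebraMap ℝ ℂ) with hM
  obtain ⟨r, hr1, hr2⟩ := ENNReal.lt_iff_exists_nnreal_btwn.1 hA
  have hr2' : r < 1 := by exact_mod_cast hr2
  have hev : ∀ᶠ n : ℕ in atTop, ‖M ^ n‖ ≤ (r : ℝ) ^ n := by
    have h := (spectrum.pow_nnnorm_pow_one_div_tendsto_nhds_spectralRadius M).eventually_lt_const hr1
    filter_upwards [h, eventually_gt_atTop 0] with n hn hn0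
    have h1 : ((‖M ^ n‖₊ : ℝ≥0∞) ^ (1 / n : ℝ)) ^ (n : ℝ) ≤ (r : ℝ≥0∞) ^ (n : ℝ) := by
      gcongr
    rw [← ENNReal.rpow_mul, one_div_mul_cancel (by positivity), ENNReal.rpow_one,
      ENNReal.rpow_natCast] at h1
    exact_mod_cast h1
  have hsum : Summable fun s : ℕ => M ^ s * (M ^ s).conjTranspose := by
    have hr2 : (r : ℝ) ^ 2 < 1 := pow_lt_one₀ r.2 (by exact_mod_cast hr2') two_ne_zero
    refine Summable.of_norm_bounded_eventually_nat
      (summable_geometric_of_lt_one (by positivity) hr2) ?_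
    filter_upwards [hev] with n hn
    calc ‖M ^ n * (M ^ n).conjTranspose‖ ≤ ‖M ^ n‖ * ‖(M ^ n).conjTranspose‖ := norm_mul_le _ _
      _ = ‖M ^ n‖ * ‖M ^ n‖ := by rw [Matrix.l2_opNorm_conjTranspose]
      _ ≤ (r : ℝ) ^ n * (r : ℝ) ^ n := by gcongr
      _ = ((r : ℝ) ^ 2) ^ n := by rw [← pow_mul, mul_comm, pow_mul, sq]; simp [mul_pow]
  have hlim := hsum.hasSum.tendsto_sum_nat
  set S := ∑' s : ℕ, M ^ s * (M ^ s).conjTranspose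
  refine ⟨S.map Complex.re, ?_⟩
  have hc : Continuous fun N : Matrix (Fin d) (Fin d) ℂ => N.map Complex.re :=
    continuous_id.matrix_map Complex.continuous_re
  have h2 := (hc.tendsto S).comp hlim
  refine h2.congr fun t => ?_
  have hterm : ∀ s, M ^ s * (M ^ s).conjTranspose =
      (A ^ s * (A ^ s).transpose).map (algebraMap ℝ ℂ) := by
    intro s
    rw [hM, Matrix.map_mul, ← Matrix.map_pow]
    congr 1
    ext i j
    simp only [Matrix.conjTranspose_apply, Matrix.map_apply, Matrix.transpose_apply,
      Complex.coe_algebraMap, Complex.star_def, Complex.conj_ofReal]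
  ext i j
  simp only [Function.comp_apply, hterm, gramian, Matrix.map_apply, Matrix.sum_apply]
  simp

end Gramian

/-! ### The basic inequality of least squares -/

section LeastSquares

variable {d : ℕ}

/-- Â is compared with the rank-one perturbation Â - u rᵀ, where r = (Â - A)ᵀu. This moves each
residual by ⟪r, x_t⟫u and needs no invertibility of the empirical covariance. -/
theorem IsOLS.sum_sq_le {x : ℕ → EuclideanSpace ℝ (Fin d)} {T : ℕ}
    {A Ahat : Matrix (Fin d) (Fin d) ℝ} (h : IsOLS x T Ahat) {u : EuclideanSpace ℝ (Fin d)}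
    (hu : ‖u‖ ≤ 1) :
    ∑ t ∈ Finset.Icc 1 T, ⟪clm (Ahat - A).transpose u, x t⟫ ^ 2 ≤
      2 * ∑ t ∈ Finset.Icc 1 T,
        ⟪u, x (t + 1) - clm A (x t)⟫ * ⟪clm (Ahat - A).transpose u, x t⟫ := by
  set r := clm (Ahat - A).transpose u with hr
  have hB := h (Ahat - (Matrix.toEuclideanCLM (n := Fin d) (𝕜 := ℝ)).symm
    ((innerSL ℝ r).smulRight u))
  rw [← sub_nonneg, lsLoss, lsLoss, ← Finset.sum_sub_distrib] at hB
  rw [← sub_nonneg, Finset.mul_sum, ← Finset.sum_sub_distrib,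
    ← mul_nonneg_iff_of_pos_left (one_half_pos (α := ℝ)), Finset.mul_sum]
  refine hB.trans (Finset.sum_le_sum fun t _ => ?_)
  set c := ⟪r, x t⟫ with hc
  have hcr : c = ⟪u, clm Ahat (x t)⟫ - ⟪u, clm A (x t)⟫ := by
    rw [hc, hr, inner_clm_transpose, clm, map_sub, _root_.sub_apply, inner_sub_right]
  have e : x (t + 1) - Matrix.toEuclideanCLM (n := Fin d) (𝕜 := ℝ)
      (Ahat - (Matrix.toEuclideanCLM (n := Fin d) (𝕜 := ℝ)).symm ((innerSL ℝ r).smulRight u)) (x t)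
      = (x (t + 1) - clm Ahat (x t)) + c • u := by
    rw [map_sub, StarAlgEquiv.apply_symm_apply, _root_.sub_apply,
      ContinuousLinearMap.smulRight_apply, innerSL_apply_apply]
    abel
  rw [e, norm_add_sq_real, norm_smul, mul_pow, Real.norm_eq_abs, sq_abs, inner_smul_right,
    inner_sub_left, inner_sub_right, real_inner_comm u (x (t + 1)),
    real_inner_comm u (clm Ahat (x t))]
  have h1 : c ^ 2 * ‖u‖ ^ 2 ≤ c ^ 2 := by
    have : ‖u‖ ^ 2 ≤ 1 := pow_le_one₀ (norm_nonneg _) hu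
    nlinarith [sq_nonneg c]
  have h2 : ⟪u, clm A (x t)⟫ = ⟪u, clm Ahat (x t)⟫ - c := by rw [hcr]; ring
  rw [h2]
  linarith

theorem opNorm_le_of_transpose {M : Matrix (Fin d) (Fin d) ℝ} {c : ℝ} (hc : 0 ≤ c)
    (h : ∀ u : EuclideanSpace ℝ (Fin d), ‖u‖ = 1 → ‖clm M.transpose u‖ ≤ c) : opNorm M ≤ c := by
  have h1 : ‖clm M.transpose‖ ≤ c := (clm M.transpose).opNorm_le_of_unit_norm hc h
  rwa [clm, ← Matrix.conjTranspose_eq_transpose_of_trivial, ← Matrix.star_eq_conjTranspose,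
    map_star, ContinuousLinearMap.star_eq_adjoint, LinearIsometryEquiv.norm_map] at h1

end LeastSquares

/-! ### One-step Gaussian integrals -/

section GaussianMoments

theorem integrable_pow_gaussianReal (v : ℝ≥0) (n : ℕ) :
    Integrable (fun z : ℝ => z ^ n) (gaussianReal 0 v) :=
  (MemLp.integrable_norm_pow' (memLp_id_gaussianReal (μ := 0) (v := v) n)).mono'
    (by fun_prop) (Eventually.of_forall fun z => by simp)

theorem integral_sq_gaussianReal (v : ℝ≥0) : ∫ z, z ^ 2 ∂gaussianReal 0 v = v := by
  have h := variance_fun_id_gaussianReal (μ := 0) (v := v)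
  rwa [variance_of_integral_eq_zero (by fun_prop) integral_id_gaussianReal] at h

theorem integral_pow_four_gaussianReal (v : ℝ≥0) :
    ∫ z, z ^ 4 ∂gaussianReal 0 v = v ^ 2 * ∫ z, z ^ 4 ∂gaussianReal 0 1 := by
  have h := gaussianReal_map_const_mul (μ := 0) (v := 1) (√(v : ℝ))
  have hv : (⟨√(v : ℝ) ^ 2, sq_nonneg _⟩ : ℝ≥0) * 1 = v := by
    ext; simp
  rw [mul_zero] at h
  erw [hv] at h
  rw [← h, integral_map (by fun_prop) (by fun_prop), ← integral_const_mul]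
  congr 1 with z
  have h2 : √(v : ℝ) ^ 2 = v := Real.sq_sqrt v.2
  linear_combination (z ^ 4 * (√(v : ℝ) ^ 2 + v)) * h2

/-- The fourth moment of the standard Gaussian distribution. -/
noncomputable def fourthMoment : ℝ := ∫ z, z ^ 4 ∂gaussianReal 0 1

theorem fourthMoment_nonneg : 0 ≤ fourthMoment :=
  integral_nonneg fun z => by positivity

theorem lintegral_add_sq_gaussianReal (v : ℝ≥0) (y : ℝ) :
    ∫⁻ z, ENNReal.ofReal ((y + z) ^ 2) ∂gaussianReal 0 v =
      ENNReal.ofReal (y ^ 2) + ENNReal.ofReal v := by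
  have h1 := integrable_pow_gaussianReal v 1
  have h2 := integrable_pow_gaussianReal v 2
  simp only [pow_one] at h1
  have e : ∀ z : ℝ, (y + z) ^ 2 = y ^ 2 + (2 * y * z + z ^ 2) := fun z => by ring
  simp_rw [e]
  rw [← ofReal_integral_eq_lintegral_ofReal, integral_add, integral_add, integral_const_mul,
    integral_sq_gaussianReal, integral_id_gaussianReal, integral_const]
  · rw [← ENNReal.ofReal_add (sq_nonneg _) v.coe_nonneg]
    simp
  · exact h1.const_mul _
  · exact h2
  · exact integrable_const _
  · exact (h1.const_mul _).add h2
  · exact (integrable_const _).add ((h1.const_mul _).add h2)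
  · exact Eventually.of_forall fun z => by
      simp only [Pi.zero_apply]
      rw [← e]; positivity

/-- One step of the martingale's variance recursion: the increment 2pz + (z² - v) is centred, so its
cross term with m integrates to zero. -/
theorem lintegral_quadratic_sq_gaussianReal_le (v : ℝ≥0) (m p : ℝ) :
    ∫⁻ z, ENNReal.ofReal ((m + ((p + z) ^ 2 - p ^ 2 - v)) ^ 2) ∂gaussianReal 0 v ≤
      ENNReal.ofReal (m ^ 2) +
        (ENNReal.ofReal (8 * v) * ENNReal.ofReal (p ^ 2) +
          ENNReal.ofReal (2 * fourthMoment * v ^ 2)) := by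
  have h1 := integrable_pow_gaussianReal v 1
  have h2 := integrable_pow_gaussianReal v 2
  have h4 := integrable_pow_gaussianReal v 4
  simp only [pow_one] at h1
  -- Coefficients of m² + 2m(2pz + z² - v) + 8p²z² + 2(z² - v)², which uses (a + b)² ≤ 2a² + 2b² on
  -- the squared increment and so avoids third moments.
  obtain ⟨c0, hc0⟩ : ∃ c0 : ℝ, c0 = m ^ 2 - 2 * m * v + 2 * v ^ 2 := ⟨_, rfl⟩
  obtain ⟨c2, hc2⟩ : ∃ c2 : ℝ, c2 = 8 * p ^ 2 + 2 * m - 4 * v := ⟨_, rfl⟩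
  have hle : ∀ z : ℝ, (m + ((p + z) ^ 2 - p ^ 2 - v)) ^ 2 ≤
      c0 + (4 * m * p * z + (c2 * z ^ 2 + 2 * z ^ 4)) := by
    intro z
    rw [hc0, hc2]
    nlinarith [sq_nonneg (2 * p * z - (z ^ 2 - v))]
  calc ∫⁻ z, ENNReal.ofReal ((m + ((p + z) ^ 2 - p ^ 2 - v)) ^ 2) ∂gaussianReal 0 v
      ≤ ∫⁻ z, ENNReal.ofReal (c0 + (4 * m * p * z + (c2 * z ^ 2 + 2 * z ^ 4)))
          ∂gaussianReal 0 v := lintegral_mono fun z => ENNReal.ofReal_le_ofReal (hle z)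
    _ = ENNReal.ofReal (c0 + c2 * v + 2 * (v ^ 2 * fourthMoment)) := by
      rw [← ofReal_integral_eq_lintegral_ofReal, integral_add, integral_add, integral_add,
        integral_const_mul, integral_const_mul, integral_const_mul, integral_sq_gaussianReal,
        integral_id_gaussianReal, integral_pow_four_gaussianReal, fourthMoment]
      · congr 1
        simp
        ring
      · exact h2.const_mul _
      · exact h4.const_mul _
      · exact h1.const_mul _
      · exact (h2.const_mul _).add (h4.const_mul _)
      · exact integrable_const _
      · exact (h1.const_mul _).add ((h2.const_mul _).add (h4.const_mul _))
      · exact (integrable_const _).add ((h1.const_mul _).add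
          ((h2.const_mul _).add (h4.const_mul _)))
      · exact Eventually.of_forall fun z => (sq_nonneg _).trans (hle z)
    _ ≤ _ := by
      have hK := fourthMoment_nonneg
      have hv : (0 : ℝ) ≤ v := v.2
      rw [← ENNReal.ofReal_mul (by positivity), ← ENNReal.ofReal_add (by positivity) (by positivity),
        ← ENNReal.ofReal_add (by positivity) (by positivity)]
      apply ENNReal.ofReal_le_ofReal
      rw [hc0, hc2]
      nlinarith [sq_nonneg (v : ℝ)]

theorem lintegral_exp_gaussianReal (v : ℝ≥0) (w c : ℝ) :
    ∫⁻ z, ENNReal.ofReal (Real.exp (w + (z * c - v / 2 * c ^ 2))) ∂gaussianReal 0 v =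
      ENNReal.ofReal (Real.exp w) := by
  have e : ∀ z : ℝ, Real.exp (w + (z * c - v / 2 * c ^ 2)) =
      Real.exp (w - v / 2 * c ^ 2) * Real.exp (c * z) := by
    intro z
    rw [← Real.exp_add]
    ring_nf
  have hi := integrable_exp_mul_gaussianReal (μ := 0) (v := v) c
  have hm : ∫ z, Real.exp (c * z) ∂gaussianReal 0 v = Real.exp (v * c ^ 2 / 2) := by
    have := congrFun (mgf_fun_id_gaussianReal (μ := 0) (v := v)) c
    simpa [mgf] using this
  simp_rw [e]
  rw [← ofReal_integral_eq_lintegral_ofReal (hi.const_mul _)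
    (Eventually.of_forall fun z => by positivity), integral_const_mul, hm, ← Real.exp_add]
  ring_nf

theorem map_inner_multivariateGaussian {d : ℕ} (σ : ℝ) (u : EuclideanSpace ℝ (Fin d)) :
    (multivariateGaussian 0 (σ ^ 2 • (1 : Matrix (Fin d) (Fin d) ℝ))).map (fun z => ⟪u, z⟫) =
      gaussianReal 0 (σ ^ 2 * ‖u‖ ^ 2).toNNReal := by
  have hS : (σ ^ 2 • (1 : Matrix (Fin d) (Fin d) ℝ)).PosSemidef :=
    Matrix.PosSemidef.one.smul (sq_nonneg σ)
  set μ := multivariateGaussian 0 (σ ^ 2 • (1 : Matrix (Fin d) (Fin d) ℝ)) with hμ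
  have h := IsGaussian.map_eq_gaussianReal (μ := μ) (innerSL ℝ u)
  have hmean : ∫ z, innerSL ℝ u z ∂μ = 0 := by
    rw [ContinuousLinearMap.integral_comp_comm _ IsGaussian.integrable_fun_id, hμ,
      integral_id_multivariateGaussian, map_zero]
  have hvar : Var[innerSL ℝ u; μ] = σ ^ 2 * ‖u‖ ^ 2 := by
    have h1 := covarianceBilin_self (μ := μ) IsGaussian.memLp_two_id u
    rw [hμ, covarianceBilin_multivariateGaussian hS] at h1
    rw [EuclideanSpace.norm_sq_eq]
    refine Eq.trans h1.symm ?_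
    simp [Matrix.smul_mulVec, dotProduct, sq, Finset.mul_sum, mul_left_comm]
  rw [hmean, hvar] at h
  exact h

end GaussianMoments

/-! ### The noise filtration and independence of new noise -/

section Past

variable {Ω E : Type*} [MeasurableSpace E] {η : ℕ → Ω → E}

/-- The σ-algebra generated by the noise strictly before time `t`. -/
abbrev past (η : ℕ → Ω → E) (t : ℕ) : MeasurableSpace Ω :=
  ⨆ s ∈ Set.Iio t, MeasurableSpace.comap (η s) inferInstance

theorem past_mono {s t : ℕ} (h : s ≤ t) : past η s ≤ past η t :=
  biSup_mono fun _ hr => lt_of_lt_of_le hr h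

theorem measurable_past {s t : ℕ} (h : s < t) : Measurable[past η t] (η s) := by
  rw [measurable_iff_comap_le]
  exact le_biSup (fun s => MeasurableSpace.comap (η s) inferInstance) (show s ∈ Set.Iio t from h)

variable [MeasurableSpace Ω] {P : Measure Ω}

theorem past_le (hη : ∀ t, Measurable (η t)) (t : ℕ) : past η t ≤ ‹MeasurableSpace Ω› :=
  iSup₂_le fun s _ => (hη s).comap_le

theorem indep_past (hη : ∀ t, Measurable (η t)) (hind : iIndepFun η P) (t : ℕ) :
    Indep (past η t) (MeasurableSpace.comap (η t) inferInstance) P := by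
  have h := indep_iSup_of_disjoint (fun s => (hη s).comap_le) hind.iIndep
    (S := Set.Iio t) (T := {t}) (by simp)
  simpa [past] using h

/-- Independence and Tonelli integrate out the newest noise with the past frozen. This plays the
role of conditional expectation, without integrability conditions. -/
theorem lintegral_past_noise [IsFiniteMeasure P] {α : Type*} [MeasurableSpace α] (hη : ∀ t, Measurable (η t))
    (hind : iIndepFun η P) {t : ℕ} {Y : Ω → α} (hY : Measurable[past η t] Y)
    {φ : E → ℝ} (hφ : Measurable φ) {ν : Measure ℝ} [SFinite ν]
    (hν : P.map (fun ω => φ (η t ω)) = ν)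
    {f : α → ℝ → ℝ≥0∞} (hf : Measurable (Function.uncurry f)) :
    ∫⁻ ω, f (Y ω) (φ (η t ω)) ∂P = ∫⁻ ω, ∫⁻ z, f (Y ω) z ∂ν ∂P := by
  have hYm : Measurable Y := hY.mono (past_le hη t) le_rfl
  have hZ : Measurable fun ω => φ (η t ω) := hφ.comp (hη t)
  have hYZ : IndepFun Y (fun ω => φ (η t ω)) P := by
    rw [IndepFun_iff_Indep]
    refine indep_of_indep_of_le_left (indep_of_indep_of_le_right (indep_past hη hind t) ?_) ?_
    · rw [← measurable_iff_comap_le]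
      exact hφ.comp (comap_measurable (η t))
    · exact measurable_iff_comap_le.1 hY
  have h := hYZ.map_prod_eq_prod_map_map hYm.aemeasurable hZ.aemeasurable
  calc ∫⁻ ω, f (Y ω) (φ (η t ω)) ∂P
      = ∫⁻ q, Function.uncurry f q ∂(P.map fun ω => (Y ω, φ (η t ω))) := by
        rw [lintegral_map hf (hYm.prodMk hZ)]; rfl
    _ = ∫⁻ y, ∫⁻ z, f y z ∂ν ∂(P.map Y) := by
        rw [h, hν, lintegral_prod _ hf.aemeasurable]; rfl
    _ = _ := by rw [lintegral_map hf.lintegral_prod_right hYm]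

end Past

/-! ### Moments of the state and of the two martingales -/

section System

variable {d : ℕ} {Ω : Type*} [MeasurableSpace Ω] {P : Measure Ω}
  {A : Matrix (Fin d) (Fin d) ℝ} {σ : ℝ} {η X : ℕ → Ω → EuclideanSpace ℝ (Fin d)}

theorem IsLinearSystem.measurable_past (h : IsLinearSystem P A σ η X) (t : ℕ) :
    Measurable[past η t] (X t) := by
  induction t with
  | zero =>
    rw [show X 0 = fun _ => 0 from funext h.init]
    exact measurable_const
  | succ t ih =>
    rw [show X (t + 1) = fun ω => clm A (X t ω) + η t ω from funext (h.step t)]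
    refine Measurable.add ?_ (LinSysId.measurable_past (Nat.lt_succ_self t))
    exact (clm A).measurable.comp (ih.mono (past_mono (Nat.le_succ t)) le_rfl)

theorem IsLinearSystem.measurable_past_of_le (h : IsLinearSystem P A σ η X) {s t : ℕ}
    (hst : s ≤ t) : Measurable[past η t] (X s) :=
  (h.measurable_past s).mono (past_mono hst) le_rfl

theorem IsLinearSystem.inner_succ (h : IsLinearSystem P A σ η X) (v : EuclideanSpace ℝ (Fin d))
    (t : ℕ) (ω : Ω) :
    ⟪v, X (t + 1) ω⟫ = ⟪clm A.transpose v, X t ω⟫ + ⟪v, η t ω⟫ := by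
  rw [h.step, inner_add_right, inner_clm_transpose]

/-- The martingale `∑_{s<t} (⟪v, X_{s+1}⟫² - ⟪v, A X_s⟫² - σ² ‖v‖²)`. -/
noncomputable def energyDefect (A : Matrix (Fin d) (Fin d) ℝ) (σ : ℝ)
    (X : ℕ → Ω → EuclideanSpace ℝ (Fin d)) (v : EuclideanSpace ℝ (Fin d)) (t : ℕ) (ω : Ω) : ℝ :=
  ∑ s ∈ Finset.range t,
    (⟪v, X (s + 1) ω⟫ ^ 2 - ⟪clm A.transpose v, X s ω⟫ ^ 2 - σ ^ 2 * ‖v‖ ^ 2)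

theorem IsLinearSystem.measurable_energyDefect (h : IsLinearSystem P A σ η X)
    (v : EuclideanSpace ℝ (Fin d)) (t : ℕ) :
    Measurable[past η t] (energyDefect A σ X v t) := by
  refine Finset.measurable_fun_sum _ fun s hs => ?_
  have hs' := Finset.mem_range.1 hs
  have h1 : Measurable[past η t] fun ω => ⟪v, X (s + 1) ω⟫ :=
    (measurable_const.inner measurable_id).comp (h.measurable_past_of_le hs')
  have h2 : Measurable[past η t] fun ω => ⟪clm A.transpose v, X s ω⟫ :=
    (measurable_const.inner measurable_id).comp (h.measurable_past_of_le hs'.le)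
  exact ((h1.pow_const 2).sub (h2.pow_const 2)).sub measurable_const

/-- The logarithm of the exponential martingale of the noise in direction `a` against the state
in direction `b`. -/
noncomputable def logLikelihood (σ : ℝ) (η X : ℕ → Ω → EuclideanSpace ℝ (Fin d))
    (a b : EuclideanSpace ℝ (Fin d)) (t : ℕ) (ω : Ω) : ℝ :=
  ∑ s ∈ Finset.range t,
    (⟪a, η s ω⟫ * ⟪b, X s ω⟫ - σ ^ 2 * ‖a‖ ^ 2 / 2 * ⟪b, X s ω⟫ ^ 2)

theorem IsLinearSystem.measurable_logLikelihood (h : IsLinearSystem P A σ η X)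
    (a b : EuclideanSpace ℝ (Fin d)) (t : ℕ) :
    Measurable[past η t] (logLikelihood σ η X a b t) := by
  refine Finset.measurable_fun_sum _ fun s hs => ?_
  have hs' := Finset.mem_range.1 hs
  have h1 : Measurable[past η t] fun ω => ⟪a, η s ω⟫ :=
    (measurable_const.inner measurable_id).comp (LinSysId.measurable_past hs')
  have h2 : Measurable[past η t] fun ω => ⟪b, X s ω⟫ :=
    (measurable_const.inner measurable_id).comp (h.measurable_past_of_le hs'.le)
  exact (h1.mul h2).sub ((h2.pow_const 2).const_mul _)

variable [IsProbabilityMeasure P]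

theorem IsLinearSystem.lintegral_past_noise (h : IsLinearSystem P A σ η X)
    (hη : ∀ t, Measurable (η t)) {α : Type*} [MeasurableSpace α] {t : ℕ} {Y : Ω → α}
    (hY : Measurable[past η t] Y) (u : EuclideanSpace ℝ (Fin d))
    {f : α → ℝ → ℝ≥0∞} (hf : Measurable (Function.uncurry f)) :
    ∫⁻ ω, f (Y ω) ⟪u, η t ω⟫ ∂P =
      ∫⁻ ω, ∫⁻ z, f (Y ω) z ∂gaussianReal 0 (σ ^ 2 * ‖u‖ ^ 2).toNNReal ∂P := by
  refine LinSysId.lintegral_past_noise hη h.noise_indep hY (φ := fun z => ⟪u, z⟫) (by fun_prop)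
    ?_ hf
  rw [← map_inner_multivariateGaussian, ← (h.noise_law t).map_eq, Measure.map_map (by fun_prop)
    (hη t)]
  rfl

theorem IsLinearSystem.lintegral_inner_sq (h : IsLinearSystem P A σ η X)
    (hη : ∀ t, Measurable (η t)) (t : ℕ) (v : EuclideanSpace ℝ (Fin d)) :
    ∫⁻ ω, ENNReal.ofReal (⟪v, X t ω⟫ ^ 2) ∂P =
      ENNReal.ofReal (σ ^ 2 * ∑ s ∈ Finset.range t, ‖(clm A.transpose)^[s] v‖ ^ 2) := by
  -- Peeling off one time step replaces v by Aᵀv, so v must vary.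
  induction t generalizing v with
  | zero => simp [h.init]
  | succ t ih =>
    have hY : Measurable[past η t] fun ω => ⟪clm A.transpose v, X t ω⟫ :=
      (measurable_const.inner measurable_id).comp (h.measurable_past t)
    simp_rw [h.inner_succ]
    rw [h.lintegral_past_noise hη hY v (f := fun y z => ENNReal.ofReal ((y + z) ^ 2))
      (by fun_prop)]
    simp_rw [lintegral_add_sq_gaussianReal]
    rw [lintegral_add_right _ measurable_const, ih, lintegral_const, measure_univ, mul_one,
      Real.coe_toNNReal _ (by positivity), ← ENNReal.ofReal_add (by positivity) (by positivity),
      Finset.sum_range_succ']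
    simp only [Function.iterate_succ_apply, Function.iterate_zero, id]
    ring_nf

/-- Martingale increments are orthogonal, so their variances add: growth is linear in t, against a
threshold for the square that is quadratic in t. -/
theorem IsLinearSystem.lintegral_energyDefect_sq_le (h : IsLinearSystem P A σ η X)
    (hη : ∀ t, Measurable (η t)) (v : EuclideanSpace ℝ (Fin d)) {q : ℝ}
    (hq : ∀ t, ∑ s ∈ Finset.range t, ‖(clm A.transpose)^[s] (clm A.transpose v)‖ ^ 2 ≤ q) (t : ℕ) :
    ∫⁻ ω, ENNReal.ofReal (energyDefect A σ X v t ω ^ 2) ∂P ≤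
      ENNReal.ofReal (t * (σ ^ 4 * (8 * ‖v‖ ^ 2 * q + 2 * fourthMoment * ‖v‖ ^ 4))) := by
  have hK := fourthMoment_nonneg
  have hq0 : 0 ≤ q := by simpa using hq 0
  induction t with
  | zero => simp [energyDefect]
  | succ t ih =>
    have h1 : Measurable[past η t] fun ω => ⟪clm A.transpose v, X t ω⟫ :=
      (measurable_const.inner measurable_id).comp (h.measurable_past t)
    have hY : Measurable[past η t] fun ω =>
        (energyDefect A σ X v t ω, ⟪clm A.transpose v, X t ω⟫) :=
      (h.measurable_energyDefect v t).prodMk h1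
    have hs : ((σ ^ 2 * ‖v‖ ^ 2).toNNReal : ℝ) = σ ^ 2 * ‖v‖ ^ 2 :=
      Real.coe_toNNReal _ (by positivity)
    have e : ∀ ω, energyDefect A σ X v (t + 1) ω = energyDefect A σ X v t ω +
        ((⟪clm A.transpose v, X t ω⟫ + ⟪v, η t ω⟫) ^ 2 - ⟪clm A.transpose v, X t ω⟫ ^ 2 -
          ((σ ^ 2 * ‖v‖ ^ 2).toNNReal : ℝ)) := by
      intro ω
      rw [energyDefect, Finset.sum_range_succ, h.inner_succ, hs, energyDefect]
    simp_rw [e]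
    rw [h.lintegral_past_noise hη hY v (f := fun y z => ENNReal.ofReal
      ((y.1 + ((y.2 + z) ^ 2 - y.2 ^ 2 - ((σ ^ 2 * ‖v‖ ^ 2).toNNReal : ℝ))) ^ 2)) (by fun_prop)]
    refine (lintegral_mono fun ω => lintegral_quadratic_sq_gaussianReal_le _ _ _).trans ?_
    have hm1 : Measurable fun ω => ENNReal.ofReal (energyDefect A σ X v t ω ^ 2) :=
      (((h.measurable_energyDefect v t).mono (past_le hη t) le_rfl).pow_const 2).ennreal_ofReal
    have hm2 : Measurable fun ω => ENNReal.ofReal (⟪clm A.transpose v, X t ω⟫ ^ 2) :=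
      ((h1.mono (past_le hη t) le_rfl).pow_const 2).ennreal_ofReal
    rw [lintegral_add_left hm1, lintegral_add_right _ measurable_const, lintegral_const_mul _ hm2,
      lintegral_const, measure_univ, mul_one, h.lintegral_inner_sq hη, hs]
    refine (add_le_add_left ih _).trans ?_
    have hsum : 0 ≤ ∑ s ∈ Finset.range t,
        ‖(clm A.transpose)^[s] (clm A.transpose v)‖ ^ 2 := by positivity
    rw [← ENNReal.ofReal_mul (by positivity), ← ENNReal.ofReal_add (by positivity) (by positivity),
      ← ENNReal.ofReal_add (by positivity) (by positivity)]
    apply ENNReal.ofReal_le_ofReal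
    have h3 : 8 * (σ ^ 2 * ‖v‖ ^ 2) * (σ ^ 2 * ∑ s ∈ Finset.range t,
        ‖(clm A.transpose)^[s] (clm A.transpose v)‖ ^ 2) ≤
        8 * (σ ^ 2 * ‖v‖ ^ 2) * (σ ^ 2 * q) := by
      gcongr
      exact hq t
    push_cast
    linarith

/-- Given the past, each factor has mean exactly one: the compensator is the Gaussian log-mgf. -/
theorem IsLinearSystem.lintegral_exp_logLikelihood (h : IsLinearSystem P A σ η X)
    (hη : ∀ t, Measurable (η t)) (a b : EuclideanSpace ℝ (Fin d)) (t : ℕ) :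
    ∫⁻ ω, ENNReal.ofReal (Real.exp (logLikelihood σ η X a b t ω)) ∂P = 1 := by
  induction t with
  | zero => simp [logLikelihood]
  | succ t ih =>
    have h1 : Measurable[past η t] fun ω => ⟪b, X t ω⟫ :=
      (measurable_const.inner measurable_id).comp (h.measurable_past t)
    have hY : Measurable[past η t] fun ω => (logLikelihood σ η X a b t ω, ⟪b, X t ω⟫) :=
      (h.measurable_logLikelihood a b t).prodMk h1
    have e : ∀ ω, logLikelihood σ η X a b (t + 1) ω = logLikelihood σ η X a b t ω +
        (⟪a, η t ω⟫ * ⟪b, X t ω⟫ -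
          ((σ ^ 2 * ‖a‖ ^ 2).toNNReal : ℝ) / 2 * ⟪b, X t ω⟫ ^ 2) := by
      intro ω
      rw [logLikelihood, Finset.sum_range_succ, Real.coe_toNNReal _ (by positivity), logLikelihood]
    simp_rw [e]
    rw [h.lintegral_past_noise hη hY a (f := fun y z => ENNReal.ofReal
      (Real.exp (y.1 + (z * y.2 - ((σ ^ 2 * ‖a‖ ^ 2).toNNReal : ℝ) / 2 * y.2 ^ 2))))
      (by fun_prop)]
    simp_rw [lintegral_exp_gaussianReal]
    exact ih

end System

/-! ### Deterministic consequences of the good events -/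

section Deterministic

variable {d : ℕ}

/-- The empirical second moment `∑_{t=0}^T ⟪v, x_t⟫²` in direction `v`. -/
noncomputable def energy (x : ℕ → EuclideanSpace ℝ (Fin d)) (T : ℕ)
    (v : EuclideanSpace ℝ (Fin d)) : ℝ :=
  ∑ t ∈ Finset.range (T + 1), ⟪v, x t⟫ ^ 2

theorem sum_Icc_one_eq_sum_range {M : Type*} [AddCommMonoid M] {f : ℕ → M} (h0 : f 0 = 0)
    (T : ℕ) : ∑ t ∈ Finset.Icc 1 T, f t = ∑ t ∈ Finset.range (T + 1), f t := by
  rw [Finset.sum_range_succ', h0, add_zero, Finset.range_eq_Ico, Finset.sum_Ico_add' f 0 T 1]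
  rfl

/-- The symmetric bilinear form `∑_t ⟪u, x_t⟫ ⟪v, x_t⟫`. -/
noncomputable def energyForm (x : ℕ → EuclideanSpace ℝ (Fin d)) (T : ℕ) :
    EuclideanSpace ℝ (Fin d) →ₗ[ℝ] EuclideanSpace ℝ (Fin d) →ₗ[ℝ] ℝ :=
  LinearMap.mk₂ ℝ (fun u v => ∑ t ∈ Finset.range (T + 1), ⟪u, x t⟫ * ⟪v, x t⟫)
    (fun a b c => by simp [inner_add_left, add_mul, Finset.sum_add_distrib])
    (fun r a b => by simp [inner_smul_left, mul_assoc, Finset.mul_sum])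
    (fun a b c => by simp [inner_add_left, mul_add, Finset.sum_add_distrib])
    (fun r a b => by simp [inner_smul_left, mul_left_comm, Finset.mul_sum])

theorem energyForm_self (x : ℕ → EuclideanSpace ℝ (Fin d)) (T : ℕ)
    (v : EuclideanSpace ℝ (Fin d)) : energyForm x T v v = energy x T v := by
  simp [energyForm, energy, sq]

theorem energyForm_comm (x : ℕ → EuclideanSpace ℝ (Fin d)) (T : ℕ)
    (u v : EuclideanSpace ℝ (Fin d)) : energyForm x T u v = energyForm x T v u := by
  simp [energyForm, mul_comm]

/-- Polarization bounds every entry of B (i = j tests 2e_i), and Cauchy–Schwarz on ∑|v_i| costs the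
factor d. -/
theorem abs_apply_self_le_of_basis {B : EuclideanSpace ℝ (Fin d) →ₗ[ℝ]
    EuclideanSpace ℝ (Fin d) →ₗ[ℝ] ℝ} (hsymm : ∀ u v, B u v = B v u) {κ : ℝ}
    (hκ : ∀ i j, |B (EuclideanSpace.single i 1 + EuclideanSpace.single j 1)
      (EuclideanSpace.single i 1 + EuclideanSpace.single j 1)| ≤ κ)
    (v : EuclideanSpace ℝ (Fin d)) : |B v v| ≤ d * κ * ‖v‖ ^ 2 := by
  set e : Fin d → EuclideanSpace ℝ (Fin d) := fun i => EuclideanSpace.single i 1 with he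
  have hentry : ∀ i j, |B (e i) (e j)| ≤ κ := by
    intro i j
    have h1 := abs_le.1 (hκ i j)
    have h2 := abs_le.1 (hκ i i)
    have h3 := abs_le.1 (hκ j j)
    change -κ ≤ B (e i + e j) (e i + e j) ∧ B (e i + e j) (e i + e j) ≤ κ at h1
    change -κ ≤ B (e i + e i) (e i + e i) ∧ B (e i + e i) (e i + e i) ≤ κ at h2
    change -κ ≤ B (e j + e j) (e j + e j) ∧ B (e j + e j) (e j + e j) ≤ κ at h3
    simp only [map_add, LinearMap.add_apply, hsymm (e j) (e i)] at h1 h2 h3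
    rw [abs_le]
    constructor <;> linarith [h1.1, h1.2, h2.1, h2.2, h3.1, h3.2]
  have hv : v = ∑ i, v i • e i := by
    ext k
    simp [he, Pi.single_apply]
  have hexp : B v v = ∑ i, ∑ j, v i * (v j * B (e i) (e j)) := by
    conv_lhs => rw [hv]
    simp only [map_sum, map_smul, LinearMap.sum_apply, LinearMap.smul_apply, smul_eq_mul,
      Finset.mul_sum]
    rw [Finset.sum_comm]
    exact Finset.sum_congr rfl fun i _ => Finset.sum_congr rfl fun j _ => by ring
  calc |B v v| ≤ ∑ i, ∑ j, |v i| * (|v j| * κ) := by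
        rw [hexp]
        refine (Finset.abs_sum_le_sum_abs _ _).trans (Finset.sum_le_sum fun i _ => ?_)
        refine (Finset.abs_sum_le_sum_abs _ _).trans (Finset.sum_le_sum fun j _ => ?_)
        rw [abs_mul, abs_mul]
        gcongr
        exact hentry i j
    _ = κ * (∑ i, |v i|) ^ 2 := by
        rw [sq, Finset.sum_mul_sum, Finset.mul_sum]
        refine Finset.sum_congr rfl fun i _ => ?_
        rw [Finset.mul_sum]
        exact Finset.sum_congr rfl fun j _ => by ring
    _ ≤ κ * (d * ‖v‖ ^ 2) := by
        rcases Nat.eq_zero_or_pos d with rfl | hd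
        · simp
        · have hκ0 : 0 ≤ κ := (abs_nonneg _).trans (hκ ⟨0, hd⟩ ⟨0, hd⟩)
          have h := sq_sum_le_card_mul_sum_sq (s := Finset.univ) (f := fun i => |v i|)
          rw [Finset.card_univ, Fintype.card_fin] at h
          rw [EuclideanSpace.norm_sq_eq]
          simp only [Real.norm_eq_abs]
          gcongr
    _ = d * κ * ‖v‖ ^ 2 := by ring

theorem energy_sub_energy {x : ℕ → EuclideanSpace ℝ (Fin d)} (hx0 : x 0 = 0) (T : ℕ)
    (A : Matrix (Fin d) (Fin d) ℝ) (σ : ℝ) (v : EuclideanSpace ℝ (Fin d)) :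
    energy x T v - energy x T (clm A.transpose v) - T * σ ^ 2 * ‖v‖ ^ 2 =
      (∑ s ∈ Finset.range T,
        (⟪v, x (s + 1)⟫ ^ 2 - ⟪clm A.transpose v, x s⟫ ^ 2 - σ ^ 2 * ‖v‖ ^ 2)) -
      ⟪clm A.transpose v, x T⟫ ^ 2 := by
  rw [energy, Finset.sum_range_succ', hx0, energy, Finset.sum_range_succ, Finset.sum_sub_distrib,
    Finset.sum_sub_distrib, Finset.sum_const, Finset.card_range, nsmul_eq_mul, inner_zero_right]
  ring

theorem energy_bounds (hd : 1 ≤ d) {A Γ : Matrix (Fin d) (Fin d) ℝ}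
    (hΓ : Tendsto (gramian A) atTop (𝓝 Γ)) {x : ℕ → EuclideanSpace ℝ (Fin d)} (hx0 : x 0 = 0)
    {T : ℕ} {σ : ℝ}
    (h1 : ∀ i j : Fin d, ∀ v, v = EuclideanSpace.single i 1 + EuclideanSpace.single j 1 →
      |∑ s ∈ Finset.range T,
        (⟪v, x (s + 1)⟫ ^ 2 - ⟪clm A.transpose v, x s⟫ ^ 2 - σ ^ 2 * ‖v‖ ^ 2)| ≤
          T * σ ^ 2 / (4 * d))
    (h2 : ∀ i j : Fin d, ∀ v, v = EuclideanSpace.single i 1 + EuclideanSpace.single j 1 →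
      ⟪clm A.transpose v, x T⟫ ^ 2 ≤ T * σ ^ 2 / (4 * d))
    (v : EuclideanSpace ℝ (Fin d)) :
    T * σ ^ 2 / 2 * ⟪v, clm Γ v⟫ ≤ energy x T v ∧
      energy x T v ≤ 3 / 2 * (T * σ ^ 2) * ⟪v, clm Γ v⟫ := by
  -- B is the defect in the Lyapunov equation for the energy.
  set B := energyForm x T - (energyForm x T).compl₁₂ (clm A.transpose).toLinearMap
      (clm A.transpose).toLinearMap - (T * σ ^ 2) • innerₗ (EuclideanSpace ℝ (Fin d)) with hB
  have hBv : ∀ v, B v v =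
      energy x T v - energy x T (clm A.transpose v) - T * σ ^ 2 * ‖v‖ ^ 2 := by
    intro v
    simp [hB, energyForm_self]
  have hsymm : ∀ u v, B u v = B v u := by
    intro u v
    simp only [hB, LinearMap.sub_apply, LinearMap.smul_apply, LinearMap.compl₁₂_apply,
      innerₗ_apply_apply]
    rw [energyForm_comm x T u v, energyForm_comm x T _ ((clm A.transpose).toLinearMap v),
      real_inner_comm]
  have hd' : (d : ℝ) ≠ 0 := by positivity
  have hBle : ∀ v, |B v v| ≤ T * σ ^ 2 / 2 * ‖v‖ ^ 2 := by
    intro v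
    -- κ is the sum of the two thresholds Tσ²/(4d); the factor d then leaves Tσ²/2, half of the main
    -- term.
    have h := abs_apply_self_le_of_basis hsymm (κ := T * σ ^ 2 / (2 * d)) (fun i j => ?_) v
    · convert h using 2
      field_simp
    · rw [hBv, energy_sub_energy hx0]
      refine (abs_sub _ _).trans ?_
      rw [abs_of_nonneg (sq_nonneg ⟪clm A.transpose _, x T⟫)]
      refine (add_le_add (h1 i j _ rfl) (h2 i j _ rfl)).trans (le_of_eq ?_)
      field_simp
      ring
  have hlim := tendsto_sum_sq_of_tendsto_gramian hΓ v
  constructor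
  · refine mul_le_of_lyapunov (g := energy x T) (fun v => Finset.sum_nonneg fun t _ => sq_nonneg _) (fun v => ?_) hlim
    have := (abs_le.1 (hBle v)).1
    rw [hBv] at this
    linarith
  · refine le_mul_of_lyapunov (Continuous.continuousAt ?_) (by simp [energy]) (fun v => ?_) hlim
    · unfold energy
      fun_prop
    · have := (abs_le.1 (hBle v)).2
      rw [hBv] at this
      linarith

theorem IsOLS.opNorm_sub_le (hd : 1 ≤ d) {A Ahat Γ : Matrix (Fin d) (Fin d) ℝ} (hΓ : Γ.PosDef)
    {x : ℕ → EuclideanSpace ℝ (Fin d)} (hx0 : x 0 = 0) {T : ℕ} (hT : 0 < T)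
    {σ : ℝ} (hσ : 0 < σ)
    (henergy : ∀ v, T * σ ^ 2 / 2 * ⟪v, clm Γ v⟫ ≤ energy x T v ∧
      energy x T v ≤ 3 / 2 * (T * σ ^ 2) * ⟪v, clm Γ v⟫)
    {e : EuclideanSpace ℝ (Fin d) ≃ₗ[ℝ] EuclideanSpace ℝ (Fin d)}
    (he : ∀ v, ‖e v‖ ^ 2 = ⟪v, clm Γ v⟫) {N : Finset (EuclideanSpace ℝ (Fin d))}
    (hN1 : ∀ v ∈ N, ‖v‖ ≤ 1) (hN : ∀ x, ‖x‖ ≤ 1 → ∃ v ∈ N, ‖x - v‖ ≤ 1 / 2) {l : ℝ} (hl : 0 < l)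
    (hmart : ∀ u ∈ N, ∀ w ∈ N, ∀ b, b = (√(l / T) / σ ^ 2) • e.symm w →
      ∑ t ∈ Finset.range (T + 1), (⟪u, x (t + 1) - clm A (x t)⟫ * ⟪b, x t⟫ -
        σ ^ 2 * ‖u‖ ^ 2 / 2 * ⟪b, x t⟫ ^ 2) ≤ l)
    (hols : IsOLS x T Ahat) :
    opNorm (Ahat - A) ≤ 32 * √(l / (T * lambdaMin Γ)) := by
  have hT' : (0 : ℝ) < T := by exact_mod_cast hT
  have hlam := lambdaMin_pos hd hΓ
  set rt := √(l / T) with hrt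
  have hrt0 : 0 < rt := Real.sqrt_pos.2 (by positivity)
  have hrt2 : rt ^ 2 * T = l := by
    rw [hrt, Real.sq_sqrt (by positivity)]
    field_simp
  set S : EuclideanSpace ℝ (Fin d) →ₗ[ℝ] EuclideanSpace ℝ (Fin d) →ₗ[ℝ] ℝ :=
    LinearMap.mk₂ ℝ (fun u v => ∑ t ∈ Finset.range (T + 1),
        ⟪u, x (t + 1) - clm A (x t)⟫ * ⟪v, x t⟫)
      (fun a b c => by simp only [inner_add_left, add_mul, Finset.sum_add_distrib])
      (fun r a b => by simp [inner_smul_left, mul_assoc, Finset.mul_sum])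
      (fun a b c => by simp only [inner_add_left, mul_add, Finset.sum_add_distrib])
      (fun r a b => by simp [inner_smul_left, mul_left_comm, Finset.mul_sum]) with hS
  have hSuv : ∀ u v, S u v = ∑ t ∈ Finset.range (T + 1),
      ⟪u, x (t + 1) - clm A (x t)⟫ * ⟪v, x t⟫ := fun u v => rfl
  have hnet : ∀ u ∈ N, ∀ w ∈ N, S.compl₂ e.symm.toLinearMap u w ≤ 2 * σ ^ 2 * T * rt := by
    intro u hu w hw
    -- At this scale the compensator is at most 3l/4, comparable to the deviation l; the total is
    -- below 2l.
    set b := (rt / σ ^ 2) • e.symm w with hb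
    have h1 := hmart u hu w hw b rfl
    rw [Finset.sum_sub_distrib, ← Finset.mul_sum, ← hSuv] at h1
    change S u b - _ * energy x T b ≤ l at h1
    have h2 := (henergy b).2
    have h3 : ‖e b‖ ≤ rt / σ ^ 2 := by
      rw [hb, map_smul, e.apply_symm_apply, norm_smul, Real.norm_of_nonneg (by positivity)]
      exact mul_le_of_le_one_right (by positivity) (hN1 w hw)
    have h4 : energy x T b ≤ 3 / 2 * (T * σ ^ 2) * (rt / σ ^ 2) ^ 2 := by
      rw [← he] at h2
      exact h2.trans (by gcongr)
    have h5 : σ ^ 2 * ‖u‖ ^ 2 / 2 * energy x T b ≤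
        σ ^ 2 * 1 / 2 * (3 / 2 * (T * σ ^ 2) * (rt / σ ^ 2) ^ 2) := by
      have : ‖u‖ ^ 2 ≤ 1 := pow_le_one₀ (norm_nonneg _) (hN1 u hu)
      have : 0 ≤ energy x T b := Finset.sum_nonneg fun t _ => sq_nonneg _
      gcongr
    have h6 : σ ^ 2 * 1 / 2 * (3 / 2 * (T * σ ^ 2) * (rt / σ ^ 2) ^ 2) = 3 / 4 * l := by
      rw [← hrt2]
      field_simp
      norm_num
    have h7 : S u b = rt / σ ^ 2 * S u (e.symm w) := by rw [hb, map_smul, smul_eq_mul]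
    have h8 : rt / σ ^ 2 * S u (e.symm w) ≤ rt / σ ^ 2 * (2 * σ ^ 2 * T * rt) := by
      have : rt / σ ^ 2 * (2 * σ ^ 2 * T * rt) = 2 * l := by
        rw [← hrt2]
        field_simp
      rw [this, ← h7]
      linarith
    exact le_of_mul_le_mul_left h8 (by positivity)
  have hsqrt : rt / √(lambdaMin Γ) = √(l / (T * lambdaMin Γ)) := by
    rw [← div_div, Real.sqrt_div (by positivity)]
  refine opNorm_le_of_transpose (by positivity) fun u hu => ?_
  set r := clm (Ahat - A).transpose u with hr
  have h1 := hols.sum_sq_le (A := A) hu.le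
  -- The t = 0 terms vanish because x_0 = 0.
  rw [← hr, sum_Icc_one_eq_sum_range (by simp [hx0]), sum_Icc_one_eq_sum_range (by simp [hx0]),
    ← hSuv] at h1
  have h2 := apply₂_le_of_half_net hN _ hnet u (e r)
  rw [LinearMap.compl₂_apply, LinearEquiv.coe_coe, e.symm_apply_apply, hu, mul_one] at h2
  have h3 := (henergy r).1
  rw [← he] at h3
  change energy x T r ≤ _ at h1
  -- Here (Tσ²/2)‖e r‖² ≤ 2 · 4 · (2σ²T rt)‖e r‖: the 4 comes from the two nets, the 2 from the
  -- basic inequality.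
  have h4 : ‖e r‖ ≤ 32 * rt := by
    by_contra! hcon
    have h5 : 0 < ‖e r‖ := by nlinarith
    have h6 : T * σ ^ 2 / 2 * ‖e r‖ * ‖e r‖ ≤ 16 * σ ^ 2 * T * rt * ‖e r‖ := by linarith
    have h7 := le_of_mul_le_mul_right h6 h5
    have h8 : T * σ ^ 2 / 2 * (32 * rt) < T * σ ^ 2 / 2 * ‖e r‖ := by gcongr
    linarith
  have h5 : √(lambdaMin Γ) * ‖r‖ ≤ ‖e r‖ := by
    refine le_of_sq_le_sq ?_ (norm_nonneg _)
    rw [mul_pow, Real.sq_sqrt hlam.le, he]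
    exact lambdaMin_mul_norm_sq_le hd hΓ.1 r
  rw [← hsqrt, ← mul_div_assoc, le_div_iff₀ (Real.sqrt_pos.2 hlam)]
  linarith

end Deterministic

/-! ### Tail bounds and the union bound -/

section Probability

variable {d : ℕ} {Ω : Type*} [MeasurableSpace Ω] {P : Measure Ω}
  {A : Matrix (Fin d) (Fin d) ℝ} {σ : ℝ} {η X : ℕ → Ω → EuclideanSpace ℝ (Fin d)}

/-- Every linear system is almost surely equal to one with measurable noise. -/
theorem IsLinearSystem.exists_measurable (h : IsLinearSystem P A σ η X) :
    ∃ η' X' : ℕ → Ω → EuclideanSpace ℝ (Fin d), IsLinearSystem P A σ η' X' ∧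
      (∀ t, Measurable (η' t)) ∧ ∀ᵐ ω ∂P, ∀ t, X t ω = X' t ω := by
  have hm : ∀ t, AEMeasurable (η t) P := fun t => (h.noise_law t).aemeasurable
  set η' : ℕ → Ω → EuclideanSpace ℝ (Fin d) := fun t => (hm t).mk (η t) with hη'
  set X' : ℕ → Ω → EuclideanSpace ℝ (Fin d) := fun t ω =>
    Nat.rec 0 (fun s y => clm A y + η' s ω) t with hX'
  refine ⟨η', X', ⟨h.noise_indep.congr fun t => (hm t).ae_eq_mk,
    fun t => (h.noise_law t).congr (hm t).ae_eq_mk.symm, fun ω => rfl, fun t ω => rfl⟩,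
    fun t => (hm t).measurable_mk, ?_⟩
  filter_upwards [ae_all_iff.2 fun t => (hm t).ae_eq_mk] with ω hω t
  induction t with
  | zero => exact h.init ω
  | succ t ih => rw [h.step, ih, hω t]

theorem measure_lt_le_of_lintegral_le {f : Ω → ℝ} (hf : Measurable f) {m c : ℝ} (hc : 0 < c)
    (h : ∫⁻ ω, ENNReal.ofReal (f ω) ∂P ≤ ENNReal.ofReal m) :
    P {ω | c < f ω} ≤ ENNReal.ofReal (m / c) := by
  calc P {ω | c < f ω} ≤ P {ω | ENNReal.ofReal c ≤ ENNReal.ofReal (f ω)} :=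
        measure_mono fun ω (hω : c < f ω) => ENNReal.ofReal_le_ofReal hω.le
    _ ≤ (∫⁻ ω, ENNReal.ofReal (f ω) ∂P) / ENNReal.ofReal c :=
        meas_ge_le_lintegral_div hf.ennreal_ofReal.aemeasurable (by simpa using hc)
          ENNReal.ofReal_ne_top
    _ ≤ ENNReal.ofReal (m / c) := by
        rw [ENNReal.ofReal_div_of_pos hc]
        gcongr

/-- The constant governing the rate at which the empirical second moments concentrate. -/
noncomputable def concentrationConst (A Γ : Matrix (Fin d) (Fin d) ℝ)
    (v : EuclideanSpace ℝ (Fin d)) : ℝ :=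
  16 * d ^ 2 * (8 * ‖v‖ ^ 2 * ⟪clm A.transpose v, clm Γ (clm A.transpose v)⟫ +
    2 * fourthMoment * ‖v‖ ^ 4) + 4 * d * ⟪clm A.transpose v, clm Γ (clm A.transpose v)⟫

variable [IsProbabilityMeasure P]

/-- Chebyshev and Markov. Both moments scale with σ as their thresholds do, so σ cancels; this is
what lets T₀ be independent of σ. -/
theorem IsLinearSystem.measure_not_concentrated_le (hd : 1 ≤ d) {Γ : Matrix (Fin d) (Fin d) ℝ}
    (hΓ : Tendsto (gramian A) atTop (𝓝 Γ)) (hσ : 0 < σ) (h : IsLinearSystem P A σ η X)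
    (hη : ∀ t, Measurable (η t)) {T : ℕ} (hT : 0 < T) (v : EuclideanSpace ℝ (Fin d)) :
    P {ω | ¬ (|energyDefect A σ X v T ω| ≤ T * σ ^ 2 / (4 * d) ∧
      ⟪clm A.transpose v, X T ω⟫ ^ 2 ≤ T * σ ^ 2 / (4 * d))} ≤
      ENNReal.ofReal (concentrationConst A Γ v / T) := by
  have hT' : (0 : ℝ) < T := by exact_mod_cast hT
  have hd' : (0 : ℝ) < d := by exact_mod_cast hd
  have hK := fourthMoment_nonneg
  set w := clm A.transpose v with hw
  set q := ⟪w, clm Γ w⟫ with hq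
  have hq0 : 0 ≤ q := (sq_nonneg _).trans (norm_sq_le_inner_of_tendsto_gramian hΓ w)
  set c : ℝ := T * σ ^ 2 / (4 * d) with hc
  have hc0 : 0 < c := by positivity
  have m1 : Measurable fun ω => energyDefect A σ X v T ω ^ 2 :=
    ((h.measurable_energyDefect v T).mono (past_le hη T) le_rfl).pow_const 2
  have m2 : Measurable fun ω => ⟪w, X T ω⟫ ^ 2 :=
    ((measurable_const.inner measurable_id).comp
      ((h.measurable_past T).mono (past_le hη T) le_rfl)).pow_const 2
  have b1 := measure_lt_le_of_lintegral_le m1 (c := c ^ 2) (by positivity)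
    (h.lintegral_energyDefect_sq_le hη v (sum_sq_le_inner_of_tendsto_gramian hΓ w) T)
  have b2 := measure_lt_le_of_lintegral_le m2 hc0 (m := σ ^ 2 * q) (by
    rw [h.lintegral_inner_sq hη]
    apply ENNReal.ofReal_le_ofReal
    gcongr
    exact sum_sq_le_inner_of_tendsto_gramian hΓ w T)
  calc P {ω | ¬ (|energyDefect A σ X v T ω| ≤ c ∧ ⟪w, X T ω⟫ ^ 2 ≤ c)}
      ≤ P ({ω | c ^ 2 < energyDefect A σ X v T ω ^ 2} ∪ {ω | c < ⟪w, X T ω⟫ ^ 2}) := by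
        refine measure_mono fun ω hω => ?_
        rcases not_and_or.1 hω with h1 | h1
        · left
          rw [not_le] at h1
          change c ^ 2 < _
          rw [← sq_abs (energyDefect A σ X v T ω)]
          gcongr
        · exact Or.inr (not_le.1 h1)
    _ ≤ _ := (measure_union_le _ _).trans (add_le_add b1 b2)
    _ = ENNReal.ofReal (concentrationConst A Γ v / T) := by
        rw [← ENNReal.ofReal_add (by positivity) (by positivity), concentrationConst, ← hw, ← hq, hc]
        congr 1
        field_simp
        ring

theorem IsLinearSystem.measure_logLikelihood_gt_le (h : IsLinearSystem P A σ η X)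
    (hη : ∀ t, Measurable (η t)) (a b : EuclideanSpace ℝ (Fin d)) (t : ℕ) (l : ℝ) :
    P {ω | l < logLikelihood σ η X a b t ω} ≤ ENNReal.ofReal (Real.exp (-l)) := by
  have hm : Measurable fun ω => Real.exp (logLikelihood σ η X a b t ω) :=
    Real.measurable_exp.comp ((h.measurable_logLikelihood a b t).mono (past_le hη t) le_rfl)
  have := measure_lt_le_of_lintegral_le hm (Real.exp_pos l) (m := 1)
    (by rw [h.lintegral_exp_logLikelihood hη, ENNReal.ofReal_one])
  simpa [Real.exp_neg] using this

theorem IsLinearSystem.measure_ols_error_gt_le (hd : 1 ≤ d) {Γ : Matrix (Fin d) (Fin d) ℝ}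
    (hΓ : Tendsto (gramian A) atTop (𝓝 Γ)) (hσ : 0 < σ) (h : IsLinearSystem P A σ η X)
    (hη : ∀ t, Measurable (η t)) {T : ℕ} (hT : 0 < T) {l : ℝ} (hl : 0 < l) :
    P {ω | ¬ ∀ Ahat : Matrix (Fin d) (Fin d) ℝ, IsOLS (fun t => X t ω) T Ahat →
      opNorm (Ahat - A) ≤ 32 * √(l / (T * lambdaMin Γ))} ≤
      ENNReal.ofReal ((∑ i : Fin d, ∑ j : Fin d, concentrationConst A Γ
        (EuclideanSpace.single i 1 + EuclideanSpace.single j 1)) / T) +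
      ENNReal.ofReal (25 ^ d * Real.exp (-l)) := by
  have hK := fourthMoment_nonneg
  have hpos := posDef_of_tendsto_gramian hΓ
  obtain ⟨e, he⟩ := exists_linearEquiv_norm_sq_eq hpos
  obtain ⟨N, hcard, hN1, hN⟩ := exists_half_net (EuclideanSpace ℝ (Fin d))
  rw [finrank_euclideanSpace, Fintype.card_fin] at hcard
  set b : EuclideanSpace ℝ (Fin d) → EuclideanSpace ℝ (Fin d) :=
    fun w => (√(l / T) / σ ^ 2) • e.symm w with hb
  set V : Fin d × Fin d → EuclideanSpace ℝ (Fin d) :=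
    fun p => EuclideanSpace.single p.1 1 + EuclideanSpace.single p.2 1 with hV
  set F : Fin d × Fin d → Set Ω := fun p =>
    {ω | ¬ (|energyDefect A σ X (V p) T ω| ≤ T * σ ^ 2 / (4 * d) ∧
      ⟪clm A.transpose (V p), X T ω⟫ ^ 2 ≤ T * σ ^ 2 / (4 * d))} with hF
  -- The horizon is T + 1 because the regression uses η_T, the noise in X_{T+1}.
  set G : EuclideanSpace ℝ (Fin d) × EuclideanSpace ℝ (Fin d) → Set Ω := fun p =>
    {ω | l < logLikelihood σ η X p.1 (b p.2) (T + 1) ω} with hG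
  have hsub : {ω | ¬ ∀ Ahat : Matrix (Fin d) (Fin d) ℝ, IsOLS (fun t => X t ω) T Ahat →
      opNorm (Ahat - A) ≤ 32 * √(l / (T * lambdaMin Γ))} ⊆
      (⋃ p ∈ (Finset.univ : Finset (Fin d × Fin d)), F p) ∪ ⋃ p ∈ N ×ˢ N, G p := by
    intro ω hω
    by_contra hcon
    simp only [Set.mem_union, Set.mem_iUnion, not_or, not_exists] at hcon
    obtain ⟨hc1, hc2⟩ := hcon
    refine hω fun Ahat hols => ?_
    have hF' : ∀ i j : Fin d, |energyDefect A σ X (V (i, j)) T ω| ≤ T * σ ^ 2 / (4 * d) ∧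
        ⟪clm A.transpose (V (i, j)), X T ω⟫ ^ 2 ≤ T * σ ^ 2 / (4 * d) := fun i j =>
      not_not.1 (hc1 (i, j) (Finset.mem_univ _))
    refine IsOLS.opNorm_sub_le hd hpos (h.init ω) hT hσ
      (energy_bounds hd hΓ (h.init ω) ?_ ?_) he hN1 hN hl ?_ hols
    · rintro i j v rfl
      exact (hF' i j).1
    · rintro i j v rfl
      exact (hF' i j).2
    · rintro u hu w hw _ rfl
      have h1 : ¬ l < logLikelihood σ η X u (b w) (T + 1) ω :=
        hc2 (u, w) (Finset.mem_product.2 ⟨hu, hw⟩)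
      have h2 : ∀ t, X (t + 1) ω - clm A (X t ω) = η t ω := fun t => by
        rw [h.step, add_sub_cancel_left]
      simp only [h2]
      exact not_lt.1 h1
  have hcc : ∀ v, 0 ≤ concentrationConst A Γ v := by
    intro v
    have : 0 ≤ ⟪clm A.transpose v, clm Γ (clm A.transpose v)⟫ :=
      (sq_nonneg _).trans (norm_sq_le_inner_of_tendsto_gramian hΓ _)
    unfold concentrationConst
    positivity
  refine (measure_mono hsub).trans ((measure_union_le _ _).trans (add_le_add ?_ ?_))
  · calc P (⋃ p ∈ (Finset.univ : Finset (Fin d × Fin d)), F p)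
        ≤ ∑ p : Fin d × Fin d, P (F p) := measure_biUnion_finset_le _ _
      _ ≤ ∑ p : Fin d × Fin d, ENNReal.ofReal (concentrationConst A Γ (V p) / T) :=
          Finset.sum_le_sum fun p _ => h.measure_not_concentrated_le hd hΓ hσ hη hT (V p)
      _ = _ := by
          rw [← ENNReal.ofReal_sum_of_nonneg fun p _ => div_nonneg (hcc _) (Nat.cast_nonneg _),
            Fintype.sum_prod_type, Finset.sum_div]
          simp_rw [Finset.sum_div]
          rfl
  · calc P (⋃ p ∈ N ×ˢ N, G p)
        ≤ ∑ p ∈ N ×ˢ N, P (G p) := measure_biUnion_finset_le _ _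
      _ ≤ ∑ p ∈ N ×ˢ N, ENNReal.ofReal (Real.exp (-l)) :=
          Finset.sum_le_sum fun p _ => h.measure_logLikelihood_gt_le hη _ _ _ _
      _ = ENNReal.ofReal ((N.card * N.card : ℕ) * Real.exp (-l)) := by
          rw [Finset.sum_const, Finset.card_product, nsmul_eq_mul,
            ENNReal.ofReal_mul (Nat.cast_nonneg _), ENNReal.ofReal_natCast]
      _ ≤ _ := by
          apply ENNReal.ofReal_le_ofReal
          gcongr
          have : N.card * N.card ≤ 25 ^ d := by
            calc N.card * N.card ≤ 5 ^ d * 5 ^ d := Nat.mul_le_mul hcard hcard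
              _ = 25 ^ d := by rw [← mul_pow]; norm_num
          exact_mod_cast this

end Probability

/-- 7 = 1 + 5 + 1, from log 2, d log 25 and -log δ; δ < 1/2 enters through log 2 ≤ log(d/δ). -/
theorem log_two_mul_pow_div_le {d : ℕ} (hd : 1 ≤ d) {δ : ℝ} (hδ : 0 < δ) (hδ' : δ < 1 / 2) :
    Real.log (2 * 25 ^ d / δ) ≤ 7 * (d * Real.log (d / δ)) := by
  have hd' : (1 : ℝ) ≤ d := by exact_mod_cast hd
  have h1 : Real.log 2 ≤ Real.log (d / δ) := by
    apply Real.log_le_log two_pos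
    rw [le_div_iff₀ hδ]
    linarith
  have h2 : -Real.log δ ≤ Real.log (d / δ) := by
    rw [Real.log_div (by positivity) hδ.ne']
    linarith [Real.log_nonneg hd']
  have h3 : Real.log 25 ≤ 5 * Real.log 2 := by
    rw [show (5 : ℝ) * Real.log 2 = Real.log (2 ^ 5) by rw [Real.log_pow]; norm_num]
    exact Real.log_le_log (by norm_num) (by norm_num)
  have h4 : 0 < Real.log 2 := Real.log_pos one_lt_two
  rw [Real.log_div (by positivity) hδ.ne', Real.log_mul (by positivity) (by positivity),
    Real.log_pow]
  have h5 : (d : ℝ) * Real.log 25 ≤ d * (5 * Real.log (d / δ)) := by gcongr; linarith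
  have h6 : Real.log (d / δ) ≤ d * Real.log (d / δ) :=
    le_mul_of_one_le_left (by linarith) hd'
  linarith

end LinSysId

open LinSysId

/-- For a stable system the Gramians converge, and beyond a time depending only on the system
matrix and on `δ` the least-squares error obeys, with probability at least `1 - δ`, the stated
bound with a universal constant `C`. -/
theorem corollary1 :
    ∃ C : ℝ, 0 < C ∧
      ∀ (d : ℕ), 1 ≤ d → ∀ (A : Matrix (Fin d) (Fin d) ℝ), LinSysId.specRadius A < 1 →
        ∃ Γinf : Matrix (Fin d) (Fin d) ℝ,
          Tendsto (LinSysId.gramian A) atTop (𝓝 Γinf) ∧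
          ∀ (δ : ℝ), 0 < δ → δ < 1 / 2 →
            ∃ T₀ : ℕ, ∀ (σ : ℝ), 0 < σ →
              ∀ (Ω : Type*) [MeasurableSpace Ω] (P : Measure Ω) [IsProbabilityMeasure P]
                (η X : ℕ → Ω → EuclideanSpace ℝ (Fin d)),
                LinSysId.IsLinearSystem P A σ η X →
                ∀ (T : ℕ), T₀ < T →
                  ENNReal.ofReal (1 - δ) ≤
                    P {ω | ∀ Ahat : Matrix (Fin d) (Fin d) ℝ,
                      LinSysId.IsOLS (fun t => X t ω) T Ahat →
                        LinSysId.opNorm (Ahat - A) ≤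
                          C * Real.sqrt ((d : ℝ) * Real.log ((d : ℝ) / δ) /
                            ((T : ℝ) * LinSysId.lambdaMin Γinf))} := by
  refine ⟨32 * √7, by positivity, fun d hd A hA => ?_⟩
  obtain ⟨Γ, hΓ⟩ := exists_tendsto_gramian hA
  refine ⟨Γ, hΓ, fun δ hδ hδ' => ?_⟩
  set c : ℝ := ∑ i : Fin d, ∑ j : Fin d, concentrationConst A Γ
    (EuclideanSpace.single i 1 + EuclideanSpace.single j 1) with hc
  -- Beyond this time the energy bounds fail with probability at most δ/2; the choice of l below
  -- gives the noise bounds the other δ/2.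
  refine ⟨⌈2 * c / δ⌉₊, fun σ hσ Ω _ P _ η X h T hT => ?_⟩
  have hT0 : 0 < T := (Nat.zero_le _).trans_lt hT
  have hT' : (0 : ℝ) < T := by exact_mod_cast hT0
  have hTc : 2 * c / δ < T := Nat.lt_of_ceil_lt hT
  have hlam := lambdaMin_pos hd (posDef_of_tendsto_gramian hΓ)
  set l := Real.log (2 * 25 ^ d / δ) with hl
  have h25 : (1 : ℝ) ≤ 25 ^ d := one_le_pow₀ (by norm_num)
  have hl0 : 0 < l := Real.log_pos (by rw [lt_div_iff₀ hδ]; linarith)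
  have hexp : 25 ^ d * Real.exp (-l) = δ / 2 := by
    rw [Real.exp_neg, hl, Real.exp_log (by positivity)]
    field_simp
  -- `HasLaw` gives only a.e. measurability, while the filtration argument needs genuinely
  -- measurable noise.
  obtain ⟨η', X', h', hη', hXX'⟩ := h.exists_measurable
  set S : Set Ω := {ω | ∀ Ahat : Matrix (Fin d) (Fin d) ℝ, IsOLS (fun t => X' t ω) T Ahat →
    opNorm (Ahat - A) ≤ 32 * √(l / (T * lambdaMin Γ))} with hS
  have hSc : P Sᶜ ≤ ENNReal.ofReal δ := by
    refine (h'.measure_ols_error_gt_le hd hΓ hσ hη' hT0 hl0).trans ?_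
    rw [hexp, ← hc]
    have hcT : c / T ≤ δ / 2 := by
      rw [div_lt_iff₀ hδ] at hTc
      rw [div_le_iff₀ hT']
      linarith
    refine (add_le_add_left (ENNReal.ofReal_le_ofReal hcT) _).trans (le_of_eq ?_)
    rw [← ENNReal.ofReal_add (by positivity) (by positivity), add_halves]
  have hSP : ENNReal.ofReal (1 - δ) ≤ P S := by
    rw [ENNReal.ofReal_sub _ hδ.le, ENNReal.ofReal_one, tsub_le_iff_right]
    -- Subadditivity avoids having to show that S is measurable.
    calc (1 : ENNReal) = P (S ∪ Sᶜ) := by rw [Set.union_compl_self, measure_univ]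
      _ ≤ P S + P Sᶜ := measure_union_le _ _
      _ ≤ P S + ENNReal.ofReal δ := by gcongr
  refine hSP.trans (measure_mono_ae ?_)
  filter_upwards [hXX'] with ω hω hmem Ahat hols
  simp only [hω] at hols
  refine (hmem Ahat hols).trans ?_
  rw [mul_assoc, ← Real.sqrt_mul (by norm_num), ← mul_div_assoc]
  gcongr
  exact log_two_mul_pow_div_le hd hδ hδ'
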